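/- **Setting.** Fix sets of threads, pointer variables $\mathit{PVar}$, data variables $\mathit{DVar}$, a nonempty set $\mathit{Adr}$ of addresses, and a data domain $\mathit{Dom}$ with an element $0$ and a relation $<$; let $\mathtt{seg}\notin\mathit{Adr}$. Pointer expressions are $p\in\mathit{PVar}$ and $a.\mathtt{next}$, data expressions are $x\in\mathit{DVar}$ and $a.\mathtt{data}$ ($a\in\mathit{Adr}$). A memory $m$ is a partial function from pointer expressions to $\mathit{Adr}\uplus\{\mathtt{seg}\}$ and from data expressions to $\mathit{Dom}$; $\bot$ means undefined. For a set $E$ of pointer expressions, $m(E)\subseteq\mathit{Adr}$ is its image without $\mathtt{seg}$, and $m|_E$ keeps $E$, all data variables, and $a.\mathtt{data}$ for $a\in m(E)$. $\mathit{adr}(m)$ consists of the addresses in the range of $m$ and those having a selector in the domain of $m$. Commands are $p:=q$, $p:=q.\mathtt{next}$, $p.\mathtt{next}:=q$, $x:=\mathit{op}(y_1,\dots,y_n)$, $x:=q.\mathtt{data}$, $p.\mathtt{data}:=y$, $\mathtt{assert}\ c$ with $c$ of the form $p=q$, $p\neq q$, $x=y$, $x\neq y$ or $x<y$, $p:=\mathtt{malloc}$,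 $\mathtt{enter}\ f(\vec p,\vec x)$ and $\mathtt{exit}$. A program gives each thread an initial location, the commands allowed in each location, and the next location after each command. A computation $\tau$ is a sequence of actions $(t,\mathit{com},\mathit{up})$ where $\mathit{com}$ is a command or an environment action $\mathtt{free}(a)$, and $\mathit{up}$ is a memory update. $\mathit{ctrl}(\tau)$ maps each thread to its location after $\tau$ (frees do not change it). The memory $m_\tau$ results from applying the updates of $\tau$ to the initial memory (pointer variables $\mathtt{seg}$, data variables $0$, selectors $\bot$). The set $\mathit{fresh}(\tau)$ is initially $\mathit{Adr}$ and loses $a$ when $a$ is freed or allocated; $\mathit{freed}(\tau)$ is initially empty, gains $a$ when $a$ is freed and loses $a$ when $a$ is allocated. The history $H(\tau)$ is the sequence of events $f(t,m(\vec p),m(\vec x))$, $\mathtt{exit}(t)$, $\mathtt{free}(a)$ of the enter, exit and free actions of $\tau$, the parameters being evaluated in the memory before the action. An observer $O$ is an automaton with an initial location, accepting locations, and transitions labelled by an event $f(\vec r)$ with formal parameters and a Boolean combination of equalities between observer variables and parameters. The values of the observer variables are chosen nondeterministically at the beginning and never change. $\mathcal S(O)$ is the set of histories that cannot reach an accepting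 location. Let $\mathcal F(h,a)=\{h' : hh'\in\mathcal S(O)$ and $h'$ frees no address other than $a\}$, and $\mathcal F(\tau,a)=\mathcal F(H(\tau),a)$. For $X\subseteq\mathit{Adr}$, the semantics $[\![X]\!]$ is the least set of computations containing $\varepsilon$ and closed under appending to $\tau$ an action of one of two kinds. (1) $(t,\mathit{com},\mathit{up})$ with a command allowed in location $\mathit{ctrl}(\tau)(t)$ and its usual update in $m_\tau$: dereferenced pointers must hold addresses; assertions must hold; pointer arguments of calls must hold addresses; the data arguments of calls and operations must be defined; $p:=\mathtt{malloc}$ has an update $[p\mapsto a,a.\mathtt{next}\mapsto\mathtt{seg},a.\mathtt{data}\mapsto d]$ with $d\in\mathit{Dom}$ arbitrary and $a\in\mathit{fresh}(\tau)$ or $a\in\mathit{freed}(\tau)\cap X$. (2) $(t,\mathtt{free}(a),[a.\mathtt{next}\mapsto\bot,a.\mathtt{data}\mapsto\bot])$ with $H(\tau).\mathtt{free}(a)\in\mathcal S(O)$. The full semantics is $[\![\mathit{Adr}]\!]$, the single-reuse semantics is $\mathit{One}=\bigcup_{a\in\mathit{Adr}}[\![\{a\}]\!]$. **Validity.** The set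 $\mathit{valid}(\tau)$ of pointer expressions is initially $\mathit{PVar}$. Assignments $p:=q$, $p.\mathtt{next}:=q$, $p:=q.\mathtt{next}$ make the assigned expression ($p$, or $a.\mathtt{next}$ where $a$ is the address held by $p$) valid if the expression read is valid and invalid otherwise; $\mathtt{free}(a)$ invalidates $a.\mathtt{next}$ and every expression holding $a$; $p:=\mathtt{malloc}$ of $a$ validates $p$ and $a.\mathtt{next}$; $\mathtt{assert}\ p=q$ validates both if one of them is valid; other actions change nothing. The valid addresses are $\mathit{adr}(m_\tau|_{\mathit{valid}(\tau)})$. **Relations.** - $\tau\sim\sigma$ iff $\mathit{ctrl}(\tau)=\mathit{ctrl}(\sigma)$ and $m_\tau|_{\mathit{valid}(\tau)}=m_\sigma|_{\mathit{valid}(\sigma)}$. - $\tau\lessdot\sigma$ iff $\mathcal F(\tau,a)\subseteq\mathcal F(\sigma,a)$ for all valid addresses $a$ of $\tau$. - $\tau\simeq_a\sigma$ iff $m_\tau(p)=a\Leftrightarrow m_\sigma(p)=a$ for all $p\in\mathit{PVar}$; $m_\tau(b.\mathtt{next})=a\Leftrightarrow m_\sigma(b.\mathtt{next})=a$ for all $b\in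 m_\tau(\mathit{valid}(\tau))$; $a\in\mathit{fresh}(\tau)\cup\mathit{freed}(\tau)\Leftrightarrow a\in\mathit{fresh}(\sigma)\cup\mathit{freed}(\sigma)$; and $\mathcal F(\tau,a)\subseteq\mathcal F(\sigma,a)$. **Pointer races.** A computation $\tau.(t,\mathit{com},\mathit{up})$ is a pointer race if $\mathit{com}$ contains $p.\mathtt{next}$ or $p.\mathtt{data}$ with $p\notin\mathit{valid}(\tau)$, or if $\mathit{com}$ is $\mathtt{enter}\ f(\vec p,\vec x)$ and, with $\vec a=m_\tau(\vec p)$, $\vec d=m_\tau(\vec x)$, there are an address $c$ and addresses $\vec b$ such that $a_i=b_i$ whenever $a_i=c$ or $p_i\in\mathit{valid}(\tau)$, and $\mathcal F(H(\tau).f(t,\vec b,\vec d),c)\not\subseteq\mathcal F(H(\tau).f(t,\vec a,\vec d),c)$. $\mathit{One}$ is pointer race free if none of its computations is a pointer race. **Reduction compatibility.** $\mathit{One}$ is reduction compatible if the following two conditions hold. 1. For all addresses $a\neq b$, all $\tau.\mathit{act}\in[\![\mathit{Adr}]\!]$, $\sigma_a.\mathit{act}\in[\![\{a\}]\!]$,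 $\sigma_b\in[\![\{b\}]\!]$, where $\mathit{act}$ is an assertion or an allocation of $a$: if $\tau\sim\sigma_a$, $\tau\lessdot\sigma_a$, $\tau\simeq_a\sigma_a$, $\tau.\mathit{act}\sim\sigma_a.\mathit{act}$, $\tau.\mathit{act}\lessdot\sigma_a.\mathit{act}$, $\tau.\mathit{act}\simeq_a\sigma_a.\mathit{act}$, $\tau\sim\sigma_b$, $\tau\lessdot\sigma_b$, $\tau\simeq_b\sigma_b$ and $\sigma_a\sim\sigma_b$, then there is $\sigma_b'\in[\![\{b\}]\!]$ with $\tau.\mathit{act}\sim\sigma_b'$, $\tau.\mathit{act}\lessdot\sigma_b'$ and $\tau.\mathit{act}\simeq_b\sigma_b'$. 2. For every history $h$ and all addresses $a\neq b$ with $h.\mathtt{free}(a)\in\mathcal S(O)$: $\mathcal F(h.\mathtt{free}(a),b)=\mathcal F(h,b)$. **Theorem.** If $\mathit{One}$ is reduction compatible and pointer race free, then the full semantics is similar to the single-reuse semantics, $[\![\mathit{Adr}]\!]\sim\mathit{One}$: every $\tau\in[\![\mathit{Adr}]\!]$ has some $\sigma\in\mathit{One}$ with $\tau\sim\sigma$,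 and every $\sigma\in\mathit{One}$ has some $\tau\in[\![\mathit{Adr}]\!]$ with $\tau\sim\sigma$. -/

import Mathlib

namespace SMR

universe u

/-! ### Memory -/

/-- Pointer values: `seg` (uninitialized) or an address. -/
inductive PVal (Adr : Type*)
  | seg
  | adr (a : Adr)

/-- Pointer expressions: pointer variables `p` and pointer selectors `a.next`. -/
inductive PExp (PVar Adr : Type*)
  | var (p : PVar)
  | next (a : Adr)

/-- Data expressions: data variables `x` and data selectors `a.data`. -/
inductive DExp (DVar Adr : Type*)
  | var (x : DVar)
  | data (a : Adr)

/-- A memory is a partial function on pointer and data expressions; `none` stands for `⊥`. -/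
@[ext]
structure Memory (PVar DVar Adr Dom : Type*) where
  ptr : PExp PVar Adr → Option (PVal Adr)
  data : DExp DVar Adr → Option Dom

/-- A single binding `e ↦ v` of a memory update (`v = none` is `e ↦ ⊥`). -/
inductive Binding (PVar DVar Adr Dom : Type*)
  | ptr (e : PExp PVar Adr) (v : Option (PVal Adr))
  | data (e : DExp DVar Adr) (v : Option Dom)

/-- Memory updates `[e₁ ↦ v₁, …, eₙ ↦ vₙ]`. -/
abbrev Update (PVar DVar Adr Dom : Type*) := List (Binding PVar DVar Adr Dom)

section MemoryOps
variable {PVar DVar Adr Dom : Type*}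

open Classical in
/-- `m[e ↦ v]` -/
noncomputable def Memory.bind (m : Memory PVar DVar Adr Dom) :
    Binding PVar DVar Adr Dom → Memory PVar DVar Adr Dom
  | .ptr e v => ⟨fun e' => if e' = e then v else m.ptr e', m.data⟩
  | .data e v => ⟨m.ptr, fun e' => if e' = e then v else m.data e'⟩

/-- `m[up]` -/
noncomputable def Memory.update (m : Memory PVar DVar Adr Dom) (up : Update PVar DVar Adr Dom) :
    Memory PVar DVar Adr Dom :=
  up.foldl Memory.bind m

/-- The initial memory: pointer variables are `seg`, data variables are `0`, selectors are
undefined. -/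
def Memory.init [Zero Dom] : Memory PVar DVar Adr Dom where
  ptr
    | .var _ => some .seg
    | .next _ => none
  data
    | .var _ => some 0
    | .data _ => none

/-- The image `m(E)` of a set of pointer expressions, without `seg`. -/
def Memory.image (m : Memory PVar DVar Adr Dom) (E : Set (PExp PVar Adr)) : Set Adr :=
  {a | ∃ e ∈ E, m.ptr e = some (.adr a)}

/-- The in-use addresses `adr(m)`: those in the range of `m` and those having a selector in the
domain of `m`. -/
def Memory.inUse (m : Memory PVar DVar Adr Dom) : Set Adr :=
  {a | (∃ e, m.ptr e = some (.adr a)) ∨ m.ptr (.next a) ≠ none ∨ m.data (.data a) ≠ none}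

open Classical in
/-- The restriction of `m` to a set `E` of pointer expressions: it keeps the expressions in `E`,
all data variables, and the data selectors of the addresses in `m(E)`. -/
noncomputable def Memory.restrict (m : Memory PVar DVar Adr Dom) (E : Set (PExp PVar Adr)) :
    Memory PVar DVar Adr Dom where
  ptr e := if e ∈ E then m.ptr e else none
  data
    | .var x => m.data (.var x)
    | .data a => if a ∈ m.image E then m.data (.data a) else none

end MemoryOps

/-! ### Commands, actions, computations -/

/-- Conditions of assertions. -/
inductive Cond (PVar DVar : Type*)
  | ptrEq (p q : PVar)
  | ptrNe (p q : PVar)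
  | dataEq (x y : DVar)
  | dataNe (x y : DVar)
  | dataLt (x y : DVar)

/-- Commands of the data structure. -/
inductive Com (PVar DVar Dom Func : Type*)
  /-- `p := q` -/
  | assign (p q : PVar)
  /-- `p := q.next` -/
  | loadNext (p q : PVar)
  /-- `p.next := q` -/
  | storeNext (p q : PVar)
  /-- `x := op(y₁, …, yₙ)` -/
  | assignOp (x : DVar) (op : List Dom → Dom) (ys : List DVar)
  /-- `x := q.data` -/
  | loadData (x : DVar) (q : PVar)
  /-- `p.data := y` -/
  | storeData (p : PVar) (y : DVar)
  /-- `assert c` -/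
  | assert (c : Cond PVar DVar)
  /-- `p := malloc` -/
  | malloc (p : PVar)
  /-- `enter func(p₁, …, pₖ, x₁, …, xₙ)` -/
  | enter (func : Func) (ps : List PVar) (xs : List DVar)
  /-- `exit` -/
  | exit

/-- What an action executes: a command of the data structure or a free by the environment. -/
inductive ActCom (PVar DVar Adr Dom Func : Type*)
  | com (c : Com PVar DVar Dom Func)
  | free (a : Adr)

/-- Actions `(t, com, up)`. -/
structure Action (Thread PVar DVar Adr Dom Func : Type*) where
  thread : Thread
  com : ActCom PVar DVar Adr Dom Func
  up : Update PVar DVar Adr Dom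

/-- Computations: `nil` is the empty computation `ε`, `snoc τ act` is `τ.act`. -/
inductive Computation (Thread PVar DVar Adr Dom Func : Type*)
  | nil
  | snoc (τ : Computation Thread PVar DVar Adr Dom Func)
      (act : Action Thread PVar DVar Adr Dom Func)

/-! ### Histories and observers -/

/-- Events: calls `func(t, a₁, …, aₖ, d₁, …, dₙ)`, `exit(t)`, and `free(a)`. -/
inductive Event (Thread Adr Dom Func : Type*)
  | call (func : Func) (t : Thread) (as : List Adr) (ds : List Dom)
  | exit (t : Thread)
  | free (a : Adr)

/-- Histories are sequences of events (the oldest event comes first). -/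
abbrev History (Thread Adr Dom Func : Type*) := List (Event Thread Adr Dom Func)

/-- Types of events. -/
inductive EventType (Func : Type*)
  | call (func : Func)
  | exit
  | free

/-- Values that occur as parameters of events and as values of observer variables. -/
inductive ObsVal (Thread Adr Dom : Type*)
  | thread (t : Thread)
  | adr (a : Adr)
  | dom (d : Dom)

/-- The type of an event. -/
def Event.type {Thread Adr Dom Func : Type*} : Event Thread Adr Dom Func → EventType Func
  | .call func _ _ _ => .call func
  | .exit _ => .exit
  | .free _ => .free

/-- The actual parameters of an event. -/
def Event.params {Thread Adr Dom Func : Type*} :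
    Event Thread Adr Dom Func → List (ObsVal Thread Adr Dom)
  | .call _ t as ds => .thread t :: (as.map .adr ++ ds.map .dom)
  | .exit t => [.thread t]
  | .free a => [.adr a]

/-- Guards: Boolean formulas over equalities of observer variables and `n` formal parameters. -/
inductive Guard (OVar : Type u) (n : ℕ) : Type u
  | tt
  | eq (l r : OVar ⊕ Fin n)
  | not (g : Guard OVar n)
  | and (g₁ g₂ : Guard OVar n)
  | or (g₁ g₂ : Guard OVar n)

/-- Truth of a guard under a valuation `φ` of the variables and actual parameters `v`. -/
def Guard.Holds {OVar : Type u} {n : ℕ} {V : Type*} (φ : OVar → V) (v : Fin n → V) :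
    Guard OVar n → Prop
  | .tt => True
  | .eq l r => Sum.elim φ v l = Sum.elim φ v r
  | .not g => ¬ g.Holds φ v
  | .and g₁ g₂ => g₁.Holds φ v ∧ g₂.Holds φ v
  | .or g₁ g₂ => g₁.Holds φ v ∨ g₂.Holds φ v

/-- Transitions of observers, labelled by an event `f(r₁, …, rₙ)` and a guard. -/
structure Transition (Func OLoc : Type*) (OVar : Type u) where
  source : OLoc
  type : EventType Func
  arity : ℕ
  guard : Guard OVar arity
  target : OLoc

/-- Observer automata. -/
structure Observer (Func OLoc : Type*) (OVar : Type u) where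
  init : OLoc
  accepting : Set OLoc
  transitions : Set (Transition Func OLoc OVar)

section Observers
variable {Thread Adr Dom Func OLoc : Type*} {OVar : Type u}

/-- The observer step `(l, φ) → (l', φ)` on an event. -/
def Observer.Step (O : Observer Func OLoc OVar) (φ : OVar → ObsVal Thread Adr Dom)
    (l : OLoc) (e : Event Thread Adr Dom Func) (l' : OLoc) : Prop :=
  ∃ tr ∈ O.transitions, tr.source = l ∧ tr.target = l' ∧ tr.type = e.type ∧
    ∃ v : Fin tr.arity → ObsVal Thread Adr Dom, List.ofFn v = e.params ∧ tr.guard.Holds φ v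

/-- The observer steps `(l, φ) → ⋯ → (l', φ)` on a history. -/
def Observer.Run (O : Observer Func OLoc OVar) (φ : OVar → ObsVal Thread Adr Dom) :
    OLoc → History Thread Adr Dom Func → OLoc → Prop
  | l, [], l' => l = l'
  | l, e :: h, l' => ∃ l₁, O.Step φ l e l₁ ∧ O.Run φ l₁ h l'

/-- The specification of an observer: the histories that are accepted from no initial state. -/
def Observer.spec (O : Observer Func OLoc OVar) : Set (History Thread Adr Dom Func) :=
  {h | ∀ φ : OVar → ObsVal Thread Adr Dom, ∀ l', O.Run φ O.init h l' → l' ∉ O.accepting}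

/-- The behavior allowed by an observer on address `a` after history `h`: the continuations of `h`
within the specification that free no address other than `a`. -/
def Observer.freeable (O : Observer Func OLoc OVar) (h : History Thread Adr Dom Func) (a : Adr) :
    Set (History Thread Adr Dom Func) :=
  {h' | h ++ h' ∈ O.spec ∧ ∀ b, Event.free b ∈ h' → b = a}

end Observers

/-! ### Programs -/

/-- The control flow of a program: every thread starts in a location; in a location it may execute
the commands that the program allows there, and the command determines its next location. -/
structure Program (Thread Loc PVar DVar Dom Func : Type*) where
  init : Thread → Loc
  Allows : Thread → Loc → Com PVar DVar Dom Func → Prop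
  next : Thread → Loc → Com PVar DVar Dom Func → Loc

section Computations
variable {Thread Loc PVar DVar Adr Dom Func : Type*}

open Classical in
/-- The control locations of the threads after a computation. Frees by the environment do not
affect the control. -/
noncomputable def Computation.ctrl (P : Program Thread Loc PVar DVar Dom Func) :
    Computation Thread PVar DVar Adr Dom Func → Thread → Loc
  | .nil => P.init
  | .snoc τ ⟨t, .com c, _⟩ => fun t' => if t' = t then P.next t (τ.ctrl P t) c else τ.ctrl P t'
  | .snoc τ ⟨_, .free _, _⟩ => τ.ctrl P

variable [Zero Dom]

/-- The memory after a computation. -/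
noncomputable def Computation.mem :
    Computation Thread PVar DVar Adr Dom Func → Memory PVar DVar Adr Dom
  | .nil => .init
  | .snoc τ act => τ.mem.update act.up

/-- The fresh addresses: those never allocated (nor freed). -/
noncomputable def Computation.fresh : Computation Thread PVar DVar Adr Dom Func → Set Adr
  | .nil => Set.univ
  | .snoc τ ⟨_, .free a, _⟩ => τ.fresh \ {a}
  | .snoc τ ⟨t, .com (.malloc p), up⟩ =>
      τ.fresh \ {a | (Computation.snoc τ ⟨t, .com (.malloc p), up⟩).mem.ptr (.var p) =
        some (.adr a)}
  | .snoc τ _ => τ.fresh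

/-- The freed addresses: those freed since their last allocation. -/
noncomputable def Computation.freed : Computation Thread PVar DVar Adr Dom Func → Set Adr
  | .nil => ∅
  | .snoc τ ⟨_, .free a, _⟩ => τ.freed ∪ {a}
  | .snoc τ ⟨t, .com (.malloc p), up⟩ =>
      τ.freed \ {a | (Computation.snoc τ ⟨t, .com (.malloc p), up⟩).mem.ptr (.var p) =
        some (.adr a)}
  | .snoc τ _ => τ.freed

/-- The address held by a pointer value, if any. -/
def PVal.toAdr : PVal Adr → Option Adr
  | .seg => none
  | .adr a => some a

/-- The history induced by a computation. In the semantics the parameters of a call are always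
defined (the pointers hold addresses), so the `filterMap`s below drop nothing. -/
noncomputable def Computation.history :
    Computation Thread PVar DVar Adr Dom Func → History Thread Adr Dom Func
  | .nil => []
  | .snoc τ ⟨_, .free a, _⟩ => τ.history ++ [.free a]
  | .snoc τ ⟨t, .com (.enter func ps xs), _⟩ =>
      τ.history ++ [.call func t
        (ps.filterMap fun p => (τ.mem.ptr (.var p)).bind PVal.toAdr)
        (xs.filterMap fun x => τ.mem.data (.var x))]
  | .snoc τ ⟨t, .com .exit, _⟩ => τ.history ++ [.exit t]
  | .snoc τ _ => τ.history

/-- The pointer expressions invalidated when `a` is freed in memory `m`: the pointers to `a` and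
the pointer selector of `a`. -/
def Memory.invalidatedBy (m : Memory PVar DVar Adr Dom) (a : Adr) : Set (PExp PVar Adr) :=
  {e | m.ptr e = some (.adr a)} ∪ {.next a}

open Classical in
/-- The valid pointer expressions of a computation. -/
noncomputable def Computation.valid :
    Computation Thread PVar DVar Adr Dom Func → Set (PExp PVar Adr)
  | .nil => Set.range .var
  | .snoc τ ⟨_, .com (.assign p q), _⟩ =>
      if .var q ∈ τ.valid then τ.valid ∪ {.var p} else τ.valid \ {.var p}
  | .snoc τ ⟨_, .com (.storeNext p q), _⟩ =>
      match τ.mem.ptr (.var p) with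
      | some (.adr a) =>
          if .var q ∈ τ.valid then τ.valid ∪ {.next a} else τ.valid \ {.next a}
      | _ => τ.valid
  | .snoc τ ⟨_, .com (.loadNext p q), _⟩ =>
      match τ.mem.ptr (.var q) with
      | some (.adr a) =>
          if .next a ∈ τ.valid then τ.valid ∪ {.var p} else τ.valid \ {.var p}
      | _ => τ.valid
  | .snoc τ ⟨_, .free a, _⟩ => τ.valid \ τ.mem.invalidatedBy a
  | .snoc τ ⟨_, .com (.malloc p), up⟩ =>
      τ.valid ∪ {e | ∃ a, Binding.ptr (.var p) (some (.adr a)) ∈ up ∧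
        (e = .var p ∨ e = .next a)}
  | .snoc τ ⟨_, .com (.assert (.ptrEq p q)), _⟩ =>
      if .var p ∈ τ.valid ∨ .var q ∈ τ.valid then τ.valid ∪ {.var p, .var q} else τ.valid
  | .snoc τ _ => τ.valid

/-! ### Semantics -/

/-- Truth of a condition in a memory. -/
def Cond.Holds [LT Dom] (m : Memory PVar DVar Adr Dom) : Cond PVar DVar → Prop
  | .ptrEq p q => m.ptr (.var p) = m.ptr (.var q)
  | .ptrNe p q => m.ptr (.var p) ≠ m.ptr (.var q)
  | .dataEq x y => m.data (.var x) = m.data (.var y)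
  | .dataNe x y => m.data (.var x) ≠ m.data (.var y)
  | .dataLt x y => ∃ d d', m.data (.var x) = some d ∧ m.data (.var y) = some d' ∧ d < d'

/-- `Exec X τ c up`: command `c` can be executed after `τ` with memory update `up`, where the
addresses in `X` may be reused. -/
inductive Exec [LT Dom] (X : Set Adr) (τ : Computation Thread PVar DVar Adr Dom Func) :
    Com PVar DVar Dom Func → Update PVar DVar Adr Dom → Prop
  | malloc (p : PVar) (a : Adr) (d : Dom) (ha : a ∈ τ.fresh ∨ a ∈ τ.freed ∩ X) :
      Exec X τ (.malloc p)
        [.ptr (.var p) (some (.adr a)), .ptr (.next a) (some .seg), .data (.data a) (some d)]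
  | enter (func : Func) (ps : List PVar) (xs : List DVar)
      (hp : ∀ p ∈ ps, ∃ a, τ.mem.ptr (.var p) = some (.adr a))
      (hx : ∀ x ∈ xs, ∃ d, τ.mem.data (.var x) = some d) :
      Exec X τ (.enter func ps xs) []
  | exit : Exec X τ .exit []
  | assign (p q : PVar) : Exec X τ (.assign p q) [.ptr (.var p) (τ.mem.ptr (.var q))]
  | storeNext (p q : PVar) (a : Adr) (ha : τ.mem.ptr (.var p) = some (.adr a)) :
      Exec X τ (.storeNext p q) [.ptr (.next a) (τ.mem.ptr (.var q))]
  | loadNext (p q : PVar) (a : Adr) (ha : τ.mem.ptr (.var q) = some (.adr a)) :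
      Exec X τ (.loadNext p q) [.ptr (.var p) (τ.mem.ptr (.next a))]
  | assignOp (x : DVar) (op : List Dom → Dom) (ys : List DVar) (ds : List Dom)
      (hd : ys.map (fun y => τ.mem.data (.var y)) = ds.map some) :
      Exec X τ (.assignOp x op ys) [.data (.var x) (some (op ds))]
  | storeData (p : PVar) (y : DVar) (a : Adr) (ha : τ.mem.ptr (.var p) = some (.adr a)) :
      Exec X τ (.storeData p y) [.data (.data a) (τ.mem.data (.var y))]
  | loadData (x : DVar) (q : PVar) (a : Adr) (ha : τ.mem.ptr (.var q) = some (.adr a)) :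
      Exec X τ (.loadData x q) [.data (.var x) (τ.mem.data (.data a))]
  | assert (c : Cond PVar DVar) (hc : c.Holds τ.mem) : Exec X τ (.assert c) []

variable [LT Dom] {OLoc : Type*} {OVar : Type u}

/-- `Step P O X τ act`: action `act` can be executed after `τ`. Commands have to respect the
control flow of the program; the environment may free every address that the observer allows to
be freed. -/
inductive Step (P : Program Thread Loc PVar DVar Dom Func) (O : Observer Func OLoc OVar)
    (X : Set Adr) (τ : Computation Thread PVar DVar Adr Dom Func) :
    Action Thread PVar DVar Adr Dom Func → Prop
  | com (t : Thread) (c : Com PVar DVar Dom Func) (up : Update PVar DVar Adr Dom)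
      (hc : P.Allows t (τ.ctrl P t) c) (hup : Exec X τ c up) : Step P O X τ ⟨t, .com c, up⟩
  | free (t : Thread) (a : Adr) (ha : τ.history ++ [.free a] ∈ O.spec) :
      Step P O X τ ⟨t, .free a, [.ptr (.next a) none, .data (.data a) none]⟩

/-- The computations of program `P` with observer `O` that reuse only addresses in `X`. -/
inductive IsComputation (P : Program Thread Loc PVar DVar Dom Func) (O : Observer Func OLoc OVar)
    (X : Set Adr) : Computation Thread PVar DVar Adr Dom Func → Prop
  | nil : IsComputation P O X .nil
  | snoc (τ : Computation Thread PVar DVar Adr Dom Func)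
      (act : Action Thread PVar DVar Adr Dom Func)
      (hτ : IsComputation P O X τ) (hact : Step P O X τ act) : IsComputation P O X (.snoc τ act)

/-- The semantics relative to the set `X` of addresses that may be reused. -/
def sem (P : Program Thread Loc PVar DVar Dom Func) (O : Observer Func OLoc OVar) (X : Set Adr) :
    Set (Computation Thread PVar DVar Adr Dom Func) :=
  {τ | IsComputation P O X τ}

/-- The full semantics: all addresses may be reused. -/
def allSem (P : Program Thread Loc PVar DVar Dom Func) (O : Observer Func OLoc OVar) :
    Set (Computation Thread PVar DVar Adr Dom Func) :=
  sem P O Set.univ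

/-- The single-reuse semantics: at most a single address is reused. -/
def oneSem (P : Program Thread Loc PVar DVar Dom Func) (O : Observer Func OLoc OVar) :
    Set (Computation Thread PVar DVar Adr Dom Func) :=
  ⋃ a : Adr, sem P O {a}

/-! ### Relations among computations -/

/-- Similarity: equal control locations and equal valid memory. -/
def Similar (P : Program Thread Loc PVar DVar Dom Func)
    (τ σ : Computation Thread PVar DVar Adr Dom Func) : Prop :=
  τ.ctrl P = σ.ctrl P ∧ τ.mem.restrict τ.valid = σ.mem.restrict σ.valid

/-- Similarity of sets of computations: every element of one set has a similar element in the
other set, and vice versa. -/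
def SetSimilar (P : Program Thread Loc PVar DVar Dom Func)
    (S T : Set (Computation Thread PVar DVar Adr Dom Func)) : Prop :=
  (∀ τ ∈ S, ∃ σ ∈ T, Similar P τ σ) ∧ (∀ σ ∈ T, ∃ τ ∈ S, Similar P τ σ)

/-- The valid addresses of a computation. -/
def Computation.validAdr (τ : Computation Thread PVar DVar Adr Dom Func) : Set Adr :=
  (τ.mem.restrict τ.valid).inUse

/-- Observer behavior inclusion. -/
def ObsIncl (O : Observer Func OLoc OVar) (τ σ : Computation Thread PVar DVar Adr Dom Func) :
    Prop :=
  ∀ a ∈ τ.validAdr, O.freeable τ.history a ⊆ O.freeable σ.history a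

/-- Memory equivalence with respect to address `a`. -/
def MemEquiv (O : Observer Func OLoc OVar) (a : Adr)
    (τ σ : Computation Thread PVar DVar Adr Dom Func) : Prop :=
  (∀ p, τ.mem.ptr (.var p) = some (.adr a) ↔ σ.mem.ptr (.var p) = some (.adr a)) ∧
  (∀ b ∈ τ.mem.image τ.valid,
    τ.mem.ptr (.next b) = some (.adr a) ↔ σ.mem.ptr (.next b) = some (.adr a)) ∧
  (a ∈ τ.fresh ∪ τ.freed ↔ a ∈ σ.fresh ∪ σ.freed) ∧
  O.freeable τ.history a ⊆ O.freeable σ.history a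

/-! ### Pointer races -/

/-- The command contains `p.next` or `p.data`. -/
def Com.Derefs (c : Com PVar DVar Dom Func) (p : PVar) : Prop :=
  match c with
  | .loadNext _ q => q = p
  | .storeNext q _ => q = p
  | .loadData _ q => q = p
  | .storeData q _ => q = p
  | _ => False

/-- `τ.act` performs an unsafe access. -/
def UnsafeAccess (τ : Computation Thread PVar DVar Adr Dom Func)
    (act : Action Thread PVar DVar Adr Dom Func) : Prop :=
  ∃ c p, act.com = .com c ∧ c.Derefs p ∧ .var p ∉ τ.valid

/-- `τ.act` performs a racy SMR call: replacing the values of invalid pointers (other than those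
pointing to some address `c`) may allow for more behavior on `c`. -/
def RacyCall (O : Observer Func OLoc OVar) (τ : Computation Thread PVar DVar Adr Dom Func)
    (act : Action Thread PVar DVar Adr Dom Func) : Prop :=
  ∃ (func : Func) (ps : List PVar) (xs : List DVar) (as : List Adr) (ds : List Dom),
    act.com = .com (.enter func ps xs) ∧
    ps.map (fun p => τ.mem.ptr (.var p)) = as.map (fun a => some (.adr a)) ∧
    xs.map (fun x => τ.mem.data (.var x)) = ds.map some ∧
    ∃ (c : Adr) (bs : List Adr), bs.length = as.length ∧
      (∀ (i : ℕ) (p : PVar) (a b : Adr), ps[i]? = some p → as[i]? = some a → bs[i]? = some b →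
        (a = c ∨ .var p ∈ τ.valid) → a = b) ∧
      ¬ O.freeable (τ.history ++ [.call func act.thread bs ds]) c ⊆
        O.freeable (τ.history ++ [.call func act.thread as ds]) c

/-- The last action of the computation is a pointer race. -/
def IsPointerRace (O : Observer Func OLoc OVar) :
    Computation Thread PVar DVar Adr Dom Func → Prop
  | .nil => False
  | .snoc τ act => UnsafeAccess τ act ∨ RacyCall O τ act

/-- A set of computations is pointer race free if none of its elements is a pointer race. -/
def PointerRaceFree (O : Observer Func OLoc OVar)
    (S : Set (Computation Thread PVar DVar Adr Dom Func)) : Prop :=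
  ∀ τ ∈ S, ¬ IsPointerRace O τ

/-! ### Reduction compatibility -/

/-- The action is an assertion. -/
def Action.IsAssert (act : Action Thread PVar DVar Adr Dom Func) : Prop :=
  ∃ c, act.com = .com (.assert c)

/-- The action is an allocation of address `a`. -/
def Action.IsMallocOf (act : Action Thread PVar DVar Adr Dom Func) (a : Adr) : Prop :=
  ∃ p, act.com = .com (.malloc p) ∧ Binding.ptr (.var p) (some (.adr a)) ∈ act.up

/-- Reduction compatibility of the single-reuse semantics. In the second part only those frees
are considered that the observer allows. -/
def ReductionCompatible (Adr : Type*) (P : Program Thread Loc PVar DVar Dom Func)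
    (O : Observer Func OLoc OVar) : Prop :=
  (∀ (a b : Adr) (τ σa σb : Computation Thread PVar DVar Adr Dom Func)
      (act : Action Thread PVar DVar Adr Dom Func),
    .snoc τ act ∈ allSem P O → .snoc σa act ∈ sem P O {a} → σb ∈ sem P O {b} →
    Similar P τ σa → ObsIncl O τ σa → MemEquiv O a τ σa →
    Similar P (.snoc τ act) (.snoc σa act) → ObsIncl O (.snoc τ act) (.snoc σa act) →
    MemEquiv O a (.snoc τ act) (.snoc σa act) →
    Similar P τ σb → ObsIncl O τ σb → MemEquiv O b τ σb →
    Similar P σa σb → a ≠ b → (act.IsAssert ∨ act.IsMallocOf a) →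
    ∃ σb' ∈ sem P O {b}, Similar P (.snoc τ act) σb' ∧ ObsIncl O (.snoc τ act) σb' ∧
      MemEquiv O b (.snoc τ act) σb') ∧
  (∀ (h : History Thread Adr Dom Func) (a b : Adr), a ≠ b → h ++ [.free a] ∈ O.spec →
    O.freeable (h ++ [.free a]) b = O.freeable h b)

end Computations

end SMR

/-! The proof is an induction on a full computation τ. For every address b it maintains a
computation σ_b that reuses only b and is coupled to τ (`Reducible`): equal control, equal valid
memory, at least the observer behavior of τ on live addresses and on b, and agreement on which
pointer variables hold b. Invalid pointers may hold different addresses in τ and σ_b. The point of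
having a whole family is that, whenever the value of an invalid pointer matters, b can be chosen as
the address which that pointer holds in τ, and then σ_b holds the same value.

An unsafe access in τ could thus be replayed as a race in the single-reuse semantics, so there is
none (`Reducible.not_unsafeAccess`). An assertion, or an allocation of a, is replayed in one
suitable σ_a, and the first condition of reduction compatibility supplies the counterparts for all
other addresses (`Reducible.exists_holds`, `Reducible.of_compatible`). A call may receive different
invalid arguments in σ_b; race freedom says that this loses no observer behavior (`Coupled.enter`).
A free is replayed in σ_b, or omitted there if its address is neither live nor b; the second
condition keeps the behavior on the other addresses unchanged (`Coupled.free`, `Coupled.free_left`).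
-/

namespace SMR

universe u

/-! ### Evaluation of memory updates. -/

section MemoryLemmas
variable {PVar DVar Adr Dom : Type*} (m : Memory PVar DVar Adr Dom)

theorem Memory.update_nil : m.update [] = m := rfl

theorem Memory.update_cons (b : Binding PVar DVar Adr Dom) (up : Update PVar DVar Adr Dom) :
    m.update (b :: up) = (m.bind b).update up := rfl

open Classical in
theorem Memory.ptr_bind_ptr (e e' : PExp PVar Adr) (v : Option (PVal Adr)) :
    (m.bind (.ptr e v)).ptr e' = if e' = e then v else m.ptr e' := rfl

theorem Memory.ptr_bind_data (e : DExp DVar Adr) (e' : PExp PVar Adr) (v : Option Dom) :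
    (m.bind (.data e v)).ptr e' = m.ptr e' := rfl

open Classical in
theorem Memory.data_bind_data (e e' : DExp DVar Adr) (v : Option Dom) :
    (m.bind (.data e v)).data e' = if e' = e then v else m.data e' := rfl

theorem Memory.data_bind_ptr (e : PExp PVar Adr) (e' : DExp DVar Adr) (v : Option (PVal Adr)) :
    (m.bind (.ptr e v)).data e' = m.data e' := rfl

end MemoryLemmas

/-! ### Invariants of race-free computations. -/

section Invariants

variable {Thread Loc PVar DVar Adr Dom Func OLoc : Type*} {OVar : Type u} [Zero Dom]

section Effects
variable (τ : Computation Thread PVar DVar Adr Dom Func) (t : Thread)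
  (up : Update PVar DVar Adr Dom)

theorem mem_snoc (act : Action Thread PVar DVar Adr Dom Func) :
    (Computation.snoc τ act).mem = τ.mem.update act.up := rfl

open Classical in
theorem valid_assign (p q : PVar) : (Computation.snoc τ ⟨t, .com (.assign p q), up⟩).valid =
    if .var q ∈ τ.valid then τ.valid ∪ {.var p} else τ.valid \ {.var p} := rfl

open Classical in
theorem valid_storeNext (p q : PVar) (a : Adr) (h : τ.mem.ptr (.var p) = some (.adr a)) :
    (Computation.snoc τ ⟨t, .com (.storeNext p q), up⟩).valid =
    if .var q ∈ τ.valid then τ.valid ∪ {.next a} else τ.valid \ {.next a} := by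
  simp [Computation.valid, h]

open Classical in
theorem valid_loadNext (p q : PVar) (a : Adr) (h : τ.mem.ptr (.var q) = some (.adr a)) :
    (Computation.snoc τ ⟨t, .com (.loadNext p q), up⟩).valid =
    if .next a ∈ τ.valid then τ.valid ∪ {.var p} else τ.valid \ {.var p} := by
  simp [Computation.valid, h]

theorem valid_free (a : Adr) : (Computation.snoc τ ⟨t, .free a, up⟩).valid =
    τ.valid \ ({e | τ.mem.ptr e = some (.adr a)} ∪ {.next a}) := rfl

theorem valid_malloc (p : PVar) (a : Adr) (d : Dom) :
    (Computation.snoc τ ⟨t, .com (.malloc p), [.ptr (.var p) (some (.adr a)),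
      .ptr (.next a) (some .seg), .data (.data a) (some d)]⟩).valid =
    τ.valid ∪ {.var p, .next a} := by
  simp only [Computation.valid]
  congr 1
  ext e
  simp

theorem fresh_malloc (p : PVar) (a : Adr) (d : Dom) :
    (Computation.snoc τ ⟨t, .com (.malloc p), [.ptr (.var p) (some (.adr a)),
      .ptr (.next a) (some .seg), .data (.data a) (some d)]⟩).fresh = τ.fresh \ {a} := by
  ext c
  simp [Computation.fresh, mem_snoc, Memory.update_cons, Memory.update_nil, Memory.ptr_bind_ptr,
    Memory.ptr_bind_data, eq_comm]

theorem freed_malloc (p : PVar) (a : Adr) (d : Dom) :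
    (Computation.snoc τ ⟨t, .com (.malloc p), [.ptr (.var p) (some (.adr a)),
      .ptr (.next a) (some .seg), .data (.data a) (some d)]⟩).freed = τ.freed \ {a} := by
  ext c
  simp [Computation.freed, mem_snoc, Memory.update_cons, Memory.update_nil, Memory.ptr_bind_ptr,
    Memory.ptr_bind_data, eq_comm]

open Classical in
theorem valid_ptrEq (p q : PVar) :
    (Computation.snoc τ ⟨t, .com (.assert (.ptrEq p q)), up⟩).valid =
    if .var p ∈ τ.valid ∨ .var q ∈ τ.valid then τ.valid ∪ {.var p, .var q} else τ.valid := rfl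

end Effects

/-- Well-formedness: valid expressions and pointer variables are defined, invalid expressions are
not `seg`, and the pointer selectors of the targets of valid expressions are defined. -/
structure WellFormed (τ : Computation Thread PVar DVar Adr Dom Func) : Prop where
  defined : ∀ e ∈ τ.valid, τ.mem.ptr e ≠ none
  var_defined : ∀ p, τ.mem.ptr (.var p) ≠ none
  invalid : ∀ e ∉ τ.valid, τ.mem.ptr e ≠ some .seg
  next_defined : ∀ e ∈ τ.valid, ∀ c, τ.mem.ptr e = some (.adr c) → τ.mem.ptr (.next c) ≠ none

/-- Without reallocations of `c ≠ a`, the expressions holding `c` are all valid until `c` is freed,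
and none of them is valid afterwards. -/
structure ReusesOnly (a : Adr) (τ : Computation Thread PVar DVar Adr Dom Func) : Prop where
  valid_of_not_freed : ∀ c, c ≠ a → c ∉ τ.freed → ∀ e, τ.mem.ptr e = some (.adr c) → e ∈ τ.valid
  not_valid_of_freed : ∀ c, c ≠ a → c ∈ τ.freed → ∀ e ∈ τ.valid, τ.mem.ptr e ≠ some (.adr c)
  next_not_valid : ∀ c, c ≠ a → c ∈ τ.freed → .next c ∉ τ.valid
  fresh_not_freed : ∀ c ∈ τ.fresh, c ∉ τ.freed

theorem WellFormed.nil :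
    WellFormed (Computation.nil : Computation Thread PVar DVar Adr Dom Func) := by
  constructor
  · rintro _ ⟨p, rfl⟩
    simp [Computation.mem, Memory.init]
  · intro p
    simp [Computation.mem, Memory.init]
  · rintro (p | c) he
    · exact absurd ⟨p, rfl⟩ he
    · simp [Computation.mem, Memory.init]
  · rintro _ ⟨p, rfl⟩
    simp [Computation.mem, Memory.init]

theorem ReusesOnly.nil (a : Adr) :
    ReusesOnly a (Computation.nil : Computation Thread PVar DVar Adr Dom Func) := by
  constructor
  · rintro c - - (p | d) h <;> simp [Computation.mem, Memory.init] at h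
  · rintro c - ⟨⟩
  · rintro c - ⟨⟩
  · rintro c - ⟨⟩

variable [LT Dom] {P : Program Thread Loc PVar DVar Dom Func} {O : Observer Func OLoc OVar}
  {X : Set Adr} {τ σ : Computation Thread PVar DVar Adr Dom Func}
  {act : Action Thread PVar DVar Adr Dom Func}

/-- Safety of accesses matters only for `p := q.next`: if `q` is valid, `next_defined` says that the
selector read is defined, so `p` remains defined. -/
theorem WellFormed.snoc (h : WellFormed τ) (hs : Step P O X τ act) (hu : ¬ UnsafeAccess τ act) :
    WellFormed (.snoc τ act) := by
  obtain ⟨h1, h2, h3, h4⟩ := h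
  cases hs with
  | free t a ha =>
    constructor <;> simp only [valid_free, mem_snoc, Memory.update_cons, Memory.update_nil,
      Memory.ptr_bind_ptr, Memory.ptr_bind_data, Set.mem_sdiff, Set.mem_union, Set.mem_ofPred_eq,
      Set.mem_singleton_iff] <;> grind
  | com t c up hc hup =>
    cases hup with
    | malloc p a d ha =>
      constructor <;> simp only [valid_malloc, mem_snoc, Memory.update_cons, Memory.update_nil,
        Memory.ptr_bind_ptr, Memory.ptr_bind_data, Set.mem_union, Set.mem_insert_iff,
        Set.mem_singleton_iff] <;> grind
    | assign p q =>
      constructor <;> simp only [valid_assign, mem_snoc, Memory.update_cons, Memory.update_nil,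
        Memory.ptr_bind_ptr] <;> grind
    | storeNext p q a ha =>
      constructor <;> simp only [valid_storeNext _ _ _ _ _ _ ha, mem_snoc, Memory.update_cons,
        Memory.update_nil, Memory.ptr_bind_ptr] <;> grind
    | loadNext p q a ha =>
      have hq : .var q ∈ τ.valid := by
        by_contra hq
        exact hu ⟨_, q, rfl, rfl, hq⟩
      constructor <;> simp only [valid_loadNext _ _ _ _ _ _ ha, mem_snoc, Memory.update_cons,
        Memory.update_nil, Memory.ptr_bind_ptr] <;> grind
    | assert c hcond =>
      cases c with
      | ptrEq p q =>
        simp only [Cond.Holds] at hcond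
        constructor <;> simp only [valid_ptrEq, mem_snoc, Memory.update_nil] <;> grind
      | _ => exact ⟨h1, h2, h3, h4⟩
    | _ => exact ⟨h1, h2, h3, h4⟩

/-- An address other than `a` is allocated only while fresh, hence while not freed, so the pointers
to it are already valid and no stale pointer is created. -/
theorem ReusesOnly.snoc {a : Adr} (h : ReusesOnly a τ) (hs : Step P O {a} τ act)
    (hu : ¬ UnsafeAccess τ act) : ReusesOnly a (.snoc τ act) := by
  obtain ⟨h1, h2, h3, h4⟩ := h
  cases hs with
  | free t b hb =>
    constructor <;> simp only [valid_free, mem_snoc, Memory.update_cons, Memory.update_nil,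
      Memory.ptr_bind_ptr, Memory.ptr_bind_data, Set.mem_sdiff, Set.mem_union, Set.mem_ofPred_eq,
      Set.mem_singleton_iff, Computation.freed, Computation.fresh] <;> grind
  | com t c up hc hup =>
    cases hup with
    | malloc p b d hb =>
      simp only [Set.mem_inter_iff, Set.mem_singleton_iff] at hb
      constructor <;> simp only [valid_malloc, mem_snoc, Memory.update_cons, Memory.update_nil,
        Memory.ptr_bind_ptr, Memory.ptr_bind_data, Set.mem_union, Set.mem_insert_iff,
        Set.mem_singleton_iff, fresh_malloc, freed_malloc, Set.mem_sdiff] <;> grind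
    | assign p q =>
      constructor <;> simp only [valid_assign, mem_snoc, Memory.update_cons, Memory.update_nil,
        Memory.ptr_bind_ptr, Computation.freed, Computation.fresh] <;> grind
    | storeNext p q b hb =>
      -- A valid `p` cannot hold a freed address other than `a`, so the store does not make the
      -- selector of such an address valid.
      have hp : .var p ∈ τ.valid := by
        by_contra hp
        exact hu ⟨_, p, rfl, rfl, hp⟩
      constructor <;> simp only [valid_storeNext _ _ _ _ _ _ hb, mem_snoc, Memory.update_cons,
        Memory.update_nil, Memory.ptr_bind_ptr, Computation.freed, Computation.fresh] <;> grind
    | loadNext p q b hb =>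
      constructor <;> simp only [valid_loadNext _ _ _ _ _ _ hb, mem_snoc, Memory.update_cons,
        Memory.update_nil, Memory.ptr_bind_ptr, Computation.freed, Computation.fresh] <;> grind
    | assert c hcond =>
      cases c with
      | ptrEq p q =>
        simp only [Cond.Holds] at hcond
        constructor <;> simp only [valid_ptrEq, mem_snoc, Memory.update_nil, Computation.freed,
          Computation.fresh] <;> grind
      | _ => exact ⟨h1, h2, h3, h4⟩
    | _ => exact ⟨h1, h2, h3, h4⟩

end Invariants

/-! ### The coupling and the relations of the statement. -/

section Coupling

variable {Thread Loc PVar DVar Adr Dom Func OLoc : Type*} {OVar : Type u} [Zero Dom]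

/-- The addresses held by valid expressions or having a valid pointer selector. -/
def Computation.live (τ : Computation Thread PVar DVar Adr Dom Func) : Set Adr :=
  {c | (∃ e ∈ τ.valid, τ.mem.ptr e = some (.adr c)) ∨ .next c ∈ τ.valid}

/-- Pointwise form of the conjunction of similarity, observer behavior inclusion, and memory
equivalence with respect to `b`, for well-formed computations. -/
structure Coupled [LT Dom] (P : Program Thread Loc PVar DVar Dom Func) (O : Observer Func OLoc OVar)
    (b : Adr) (τ σ : Computation Thread PVar DVar Adr Dom Func) : Prop where
  ctrl : τ.ctrl P = σ.ctrl P
  valid : τ.valid = σ.valid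
  ptr : ∀ e ∈ τ.valid, τ.mem.ptr e = σ.mem.ptr e
  dvar : ∀ x, τ.mem.data (.var x) = σ.mem.data (.var x)
  data : ∀ e ∈ τ.valid, ∀ c, τ.mem.ptr e = some (.adr c) →
    τ.mem.data (.data c) = σ.mem.data (.data c)
  incl : ∀ c, c ∈ τ.live ∨ c = b → O.freeable τ.history c ⊆ O.freeable σ.history c
  var_iff : ∀ p, τ.mem.ptr (.var p) = some (.adr b) ↔ σ.mem.ptr (.var p) = some (.adr b)
  next_iff : ∀ e ∈ τ.valid, ∀ c, τ.mem.ptr e = some (.adr c) →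
    (τ.mem.ptr (.next c) = some (.adr b) ↔ σ.mem.ptr (.next c) = some (.adr b))
  avail_iff : b ∈ τ.fresh ∪ τ.freed ↔ b ∈ σ.fresh ∪ σ.freed

variable {τ σ : Computation Thread PVar DVar Adr Dom Func}

theorem validAdr_subset_live : τ.validAdr ⊆ τ.live := by
  rintro c (⟨e, he⟩ | hc | hc)
  · simp only [Memory.restrict, Option.ite_none_right_eq_some] at he
    exact .inl ⟨e, he⟩
  · right
    by_contra h
    exact hc (if_neg h)
  · left
    by_contra h
    exact hc (if_neg h)

theorem WellFormed.validAdr_eq_live (h : WellFormed τ) : τ.validAdr = τ.live := by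
  refine validAdr_subset_live.antisymm ?_
  rintro c (⟨e, he, hc⟩ | hc)
  · exact .inl ⟨e, by simp [Memory.restrict, he, hc]⟩
  · exact .inr (.inl (by simpa [Memory.restrict, hc] using h.defined _ hc))

variable [LT Dom] {P : Program Thread Loc PVar DVar Dom Func} {O : Observer Func OLoc OVar}
  {X : Set Adr} {act : Action Thread PVar DVar Adr Dom Func} {b : Adr}

theorem Coupled.similar (h : Coupled P O b τ σ) : Similar P τ σ := by
  have hi : τ.mem.image τ.valid = σ.mem.image σ.valid := by
    ext c
    constructor <;> rintro ⟨e, he, hc⟩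
    · exact ⟨e, h.valid ▸ he, h.ptr e he ▸ hc⟩
    · rw [← h.valid] at he
      exact ⟨e, he, h.ptr e he ▸ hc⟩
  refine ⟨h.ctrl, ?_⟩
  ext1
  · funext e
    by_cases he : e ∈ τ.valid
    · simp [Memory.restrict, ← h.valid, he, h.ptr]
    · simp [Memory.restrict, ← h.valid, he]
  · funext e
    cases e with
    | var x => exact h.dvar x
    | data c =>
      by_cases hc : c ∈ τ.mem.image τ.valid
      · simp only [Memory.restrict, if_pos hc, if_pos (hi ▸ hc)]
        obtain ⟨e, he, hc⟩ := hc
        exact h.data e he c hc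
      · simp only [Memory.restrict, if_neg hc, if_neg (hi ▸ hc)]

theorem Coupled.obsIncl (h : Coupled P O b τ σ) : ObsIncl O τ σ :=
  fun c hc => h.incl c (.inl (validAdr_subset_live hc))

theorem Coupled.memEquiv (h : Coupled P O b τ σ) : MemEquiv O b τ σ :=
  ⟨h.var_iff, fun c ⟨e, he, hc⟩ => h.next_iff e he c hc, h.avail_iff, h.incl b (.inr rfl)⟩

/-- Valid expressions are defined, so the domain of the restricted memory is exactly the set of
valid expressions; equal restrictions therefore force equal validity. -/
theorem Coupled.of_relations (hτ : WellFormed τ) (hσ : WellFormed σ) (hs : Similar P τ σ)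
    (ho : ObsIncl O τ σ) (hm : MemEquiv O b τ σ) : Coupled P O b τ σ := by
  obtain ⟨hctrl, hmem⟩ := hs
  have hptr := fun e => congrFun (congrArg Memory.ptr hmem) e
  have hdata := fun e => congrFun (congrArg Memory.data hmem) e
  have h1 := hτ.defined
  have h2 := hσ.defined
  simp only [Memory.restrict] at hptr
  have hv : τ.valid = σ.valid := by
    ext e
    grind
  have hp : ∀ e ∈ τ.valid, τ.mem.ptr e = σ.mem.ptr e := by grind
  refine ⟨hctrl, hv, hp, fun x => hdata (.var x), fun e he c hc => ?_, ?_, hm.1,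
    fun e he c hc => hm.2.1 c ⟨e, he, hc⟩, hm.2.2.1⟩
  · have := hdata (.data c)
    simp only [Memory.restrict] at this
    rwa [if_pos ⟨e, he, hc⟩, if_pos ⟨e, hv ▸ he, hp e he ▸ hc⟩] at this
  · rintro c (hc | rfl)
    · exact ho c (hτ.validAdr_eq_live ▸ hc)
    · exact hm.2.2.2

end Coupling

/-! ### Preservation of the coupling by single actions. -/

section CoupledSteps

variable {Thread Loc PVar DVar Adr Dom Func OLoc : Type*} {OVar : Type u}
  {O : Observer Func OLoc OVar}

theorem cons_mem_freeable {h h' : History Thread Adr Dom Func} {e : Event Thread Adr Dom Func}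
    {c : Adr} (he : ∀ d, .free d = e → d = c) :
    e :: h' ∈ O.freeable h c ↔ h' ∈ O.freeable (h ++ [e]) c := by
  simp only [Observer.freeable, Set.mem_ofPred_eq, List.append_assoc, List.cons_append,
    List.nil_append, List.mem_cons]
  grind

/-- `freeable` is a residual: an event can be moved from the continuation to the history, provided
it does not free an address other than `c`. -/
theorem freeable_append_mono {h₁ h₂ : History Thread Adr Dom Func} {e : Event Thread Adr Dom Func}
    {c : Adr} (he : ∀ d, .free d = e → d = c) (h : O.freeable h₁ c ⊆ O.freeable h₂ c) :
    O.freeable (h₁ ++ [e]) c ⊆ O.freeable (h₂ ++ [e]) c := fun _ h' =>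
  (cons_mem_freeable he).1 (h ((cons_mem_freeable he).2 h'))

theorem free_mem_spec {h₁ h₂ : History Thread Adr Dom Func} {c : Adr}
    (h : O.freeable h₁ c ⊆ O.freeable h₂ c) (hc : h₁ ++ [.free c] ∈ O.spec) :
    h₂ ++ [.free c] ∈ O.spec :=
  (h (show [.free c] ∈ O.freeable h₁ c from ⟨hc, by simp⟩)).1

theorem ctrl_snoc_com {P : Program Thread Loc PVar DVar Dom Func}
    {τ σ : Computation Thread PVar DVar Adr Dom Func} (h : τ.ctrl P = σ.ctrl P) (t : Thread) (c : Com PVar DVar Dom Func)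
    (up up' : Update PVar DVar Adr Dom) : (Computation.snoc τ ⟨t, .com c, up⟩).ctrl P =
      (Computation.snoc σ ⟨t, .com c, up'⟩).ctrl P := by
  simp [Computation.ctrl, h]

variable [Zero Dom] [LT Dom] {P : Program Thread Loc PVar DVar Dom Func}
  {X : Set Adr} {τ σ : Computation Thread PVar DVar Adr Dom Func}
  {act : Action Thread PVar DVar Adr Dom Func} {b : Adr}

theorem Coupled.assign (h : Coupled P O b τ σ) (t : Thread) (p q : PVar) :
    Coupled P O b (.snoc τ ⟨t, .com (.assign p q), [.ptr (.var p) (τ.mem.ptr (.var q))]⟩)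
      (.snoc σ ⟨t, .com (.assign p q), [.ptr (.var p) (σ.mem.ptr (.var q))]⟩) := by
  obtain ⟨h1, h2, h3, h4, h5, h6, h7, h8, h9⟩ := h
  refine ⟨ctrl_snoc_com h1 .., ?_, ?_, h4, ?_, ?_, ?_, ?_, h9⟩ <;>
  simp only [Computation.live, Computation.history, Set.mem_ofPred_eq, valid_assign, mem_snoc,
    Memory.update_cons, Memory.update_nil, Memory.ptr_bind_ptr, Memory.data_bind_ptr] at h6 ⊢ <;>
  grind

/-- Validity of `p` makes both computations write to the same selector. -/
theorem Coupled.storeNext (h : Coupled P O b τ σ) (t : Thread) (p q : PVar) (a : Adr)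
    (hp : .var p ∈ τ.valid) (hτ : τ.mem.ptr (.var p) = some (.adr a)) :
    Coupled P O b (.snoc τ ⟨t, .com (.storeNext p q), [.ptr (.next a) (τ.mem.ptr (.var q))]⟩)
      (.snoc σ ⟨t, .com (.storeNext p q), [.ptr (.next a) (σ.mem.ptr (.var q))]⟩) := by
  obtain ⟨h1, h2, h3, h4, h5, h6, h7, h8, h9⟩ := h
  have hσ := (h3 _ hp).symm.trans hτ
  refine ⟨ctrl_snoc_com h1 .., ?_, ?_, h4, ?_, ?_, ?_, ?_, h9⟩ <;>
  simp only [Computation.live, Computation.history, Set.mem_ofPred_eq,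
    valid_storeNext _ _ _ _ _ _ hτ, valid_storeNext _ _ _ _ _ _ hσ, mem_snoc,
    Memory.update_cons, Memory.update_nil, Memory.ptr_bind_ptr, Memory.data_bind_ptr] at h6 ⊢ <;>
  grind

/-- `next_iff` serves this case: even if the selector read is invalid, `p` receives `b` in both
computations or in neither. -/
theorem Coupled.loadNext (h : Coupled P O b τ σ) (t : Thread) (p q : PVar) (a : Adr)
    (hq : .var q ∈ τ.valid) (hτ : τ.mem.ptr (.var q) = some (.adr a)) :
    Coupled P O b (.snoc τ ⟨t, .com (.loadNext p q), [.ptr (.var p) (τ.mem.ptr (.next a))]⟩)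
      (.snoc σ ⟨t, .com (.loadNext p q), [.ptr (.var p) (σ.mem.ptr (.next a))]⟩) := by
  obtain ⟨h1, h2, h3, h4, h5, h6, h7, h8, h9⟩ := h
  have hσ := (h3 _ hq).symm.trans hτ
  refine ⟨ctrl_snoc_com h1 .., ?_, ?_, h4, ?_, ?_, ?_, ?_, h9⟩ <;>
  simp only [Computation.live, Computation.history, Set.mem_ofPred_eq,
    valid_loadNext _ _ _ _ _ _ hτ, valid_loadNext _ _ _ _ _ _ hσ, mem_snoc,
    Memory.update_cons, Memory.update_nil, Memory.ptr_bind_ptr, Memory.data_bind_ptr] at h6 ⊢ <;>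
  grind

theorem Coupled.assignOp (h : Coupled P O b τ σ) (t : Thread) (x : DVar) (op : List Dom → Dom)
    (ys : List DVar) (v : Option Dom) :
    Coupled P O b (.snoc τ ⟨t, .com (.assignOp x op ys), [.data (.var x) v]⟩)
      (.snoc σ ⟨t, .com (.assignOp x op ys), [.data (.var x) v]⟩) := by
  refine ⟨ctrl_snoc_com h.ctrl .., h.valid, h.ptr, ?_, ?_, h.incl, h.var_iff, h.next_iff,
    h.avail_iff⟩
  · intro y
    simp only [mem_snoc, Memory.update_cons, Memory.update_nil, Memory.data_bind_data, h.dvar]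
  · intro e he c hc
    simpa [mem_snoc, Memory.update_cons, Memory.update_nil, Memory.data_bind_data] using
      h.data e he c hc

theorem Coupled.loadData (h : Coupled P O b τ σ) (t : Thread) (x : DVar) (q : PVar)
    (v : Option Dom) :
    Coupled P O b (.snoc τ ⟨t, .com (.loadData x q), [.data (.var x) v]⟩)
      (.snoc σ ⟨t, .com (.loadData x q), [.data (.var x) v]⟩) := by
  refine ⟨ctrl_snoc_com h.ctrl .., h.valid, h.ptr, ?_, ?_, h.incl, h.var_iff, h.next_iff,
    h.avail_iff⟩
  · intro y
    simp only [mem_snoc, Memory.update_cons, Memory.update_nil, Memory.data_bind_data, h.dvar]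
  · intro e he c hc
    simpa [mem_snoc, Memory.update_cons, Memory.update_nil, Memory.data_bind_data] using
      h.data e he c hc

theorem Coupled.storeData (h : Coupled P O b τ σ) (t : Thread) (p : PVar) (y : DVar) (a : Adr)
    (v : Option Dom) :
    Coupled P O b (.snoc τ ⟨t, .com (.storeData p y), [.data (.data a) v]⟩)
      (.snoc σ ⟨t, .com (.storeData p y), [.data (.data a) v]⟩) := by
  refine ⟨ctrl_snoc_com h.ctrl .., h.valid, h.ptr, ?_, ?_, h.incl, h.var_iff, h.next_iff,
    h.avail_iff⟩
  · intro y
    simpa [mem_snoc, Memory.update_cons, Memory.update_nil, Memory.data_bind_data] using h.dvar y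
  · intro e he c hc
    simp only [mem_snoc, Memory.update_cons, Memory.update_nil, Memory.data_bind_data,
      h.data e he c hc]

/-- An equality may validate an invalid pointer. As it holds in both memories, that pointer has the
value of a valid one, on which the memories agree. -/
theorem Coupled.assert (h : Coupled P O b τ σ) (t : Thread) (c : Cond PVar DVar)
    (hτ : c.Holds τ.mem) (hσ : c.Holds σ.mem) :
    Coupled P O b (.snoc τ ⟨t, .com (.assert c), []⟩) (.snoc σ ⟨t, .com (.assert c), []⟩) := by
  have hc := ctrl_snoc_com h.ctrl t (.assert c) [] []
  cases c with
  | ptrEq p q =>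
    obtain ⟨h1, h2, h3, h4, h5, h6, h7, h8, h9⟩ := h
    simp only [Cond.Holds] at hτ hσ
    refine ⟨hc, ?_, ?_, h4, ?_, ?_, h7, ?_, h9⟩ <;>
    simp only [Computation.live, Computation.history, Set.mem_ofPred_eq, valid_ptrEq, mem_snoc,
      Memory.update_nil] at h6 ⊢ <;>
    grind
  | _ => exact ⟨hc, h.valid, h.ptr, h.dvar, h.data, h.incl, h.var_iff, h.next_iff, h.avail_iff⟩

/-- Only the allocation of `b` itself is mirrored. It can make `b` live, and `incl` covers `b`
already before it is live. -/
theorem Coupled.malloc (h : Coupled P O b τ σ) (t : Thread) (p : PVar) (d : Dom) :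
    Coupled P O b (.snoc τ ⟨t, .com (.malloc p), [.ptr (.var p) (some (.adr b)),
      .ptr (.next b) (some .seg), .data (.data b) (some d)]⟩)
      (.snoc σ ⟨t, .com (.malloc p), [.ptr (.var p) (some (.adr b)),
      .ptr (.next b) (some .seg), .data (.data b) (some d)]⟩) := by
  obtain ⟨h1, h2, h3, h4, h5, h6, h7, h8, h9⟩ := h
  refine ⟨ctrl_snoc_com h1 .., ?_, ?_, ?_, ?_, ?_, ?_, ?_, ?_⟩ <;>
  simp only [Computation.live, Computation.history, Set.mem_ofPred_eq,
    valid_malloc, fresh_malloc, freed_malloc, mem_snoc, Memory.update_cons, Memory.update_nil,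
    Memory.ptr_bind_ptr, Memory.ptr_bind_data, Memory.data_bind_ptr, Memory.data_bind_data,
    Set.mem_union, Set.mem_insert_iff, Set.mem_singleton_iff, Set.mem_sdiff] at h6 h9 ⊢ <;>
  grind

/-- Behavior on `a` is inherited because the same event is appended to both histories; behavior on
any other address is unaffected by the free, by `hstable`. -/
theorem Coupled.free (h : Coupled P O b τ σ) (t : Thread) (a : Adr)
    (hstable : ∀ (h : History Thread Adr Dom Func) (a b : Adr), a ≠ b → h ++ [.free a] ∈ O.spec →
      O.freeable (h ++ [.free a]) b = O.freeable h b)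
    (hτ : τ.history ++ [.free a] ∈ O.spec) (ha : a ∈ τ.live ∨ a = b) :
    Coupled P O b (.snoc τ ⟨t, .free a, [.ptr (.next a) none, .data (.data a) none]⟩)
      (.snoc σ ⟨t, .free a, [.ptr (.next a) none, .data (.data a) none]⟩) := by
  have hσ : σ.history ++ [.free a] ∈ O.spec := free_mem_spec (h.incl a ha) hτ
  have key : ∀ c, c ∈ τ.live ∨ c = b →
      O.freeable (τ.history ++ [.free a]) c ⊆ O.freeable (σ.history ++ [.free a]) c := by
    intro c hc
    by_cases hac : a = c
    · subst hac
      exact freeable_append_mono (by simp) (h.incl a ha)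
    · rw [hstable _ _ _ hac hτ, hstable _ _ _ hac hσ]
      exact h.incl c hc
  obtain ⟨h1, h2, h3, h4, h5, h6, h7, h8, h9⟩ := h
  refine ⟨h1, ?_, ?_, ?_, ?_, ?_, ?_, ?_, ?_⟩ <;>
  simp only [Computation.live, Computation.history, Set.mem_ofPred_eq, Computation.fresh,
    Computation.freed,
    valid_free, mem_snoc, Memory.update_cons, Memory.update_nil,
    Memory.ptr_bind_ptr, Memory.ptr_bind_data, Memory.data_bind_ptr, Memory.data_bind_data,
    Set.mem_union, Set.mem_singleton_iff, Set.mem_sdiff] at key h9 ⊢ <;>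
  grind

/-- No valid expression refers to an `a` that is not live, so its free changes nothing that the
coupling observes and `σ` can stay put. -/
theorem Coupled.free_left (h : Coupled P O b τ σ) (t : Thread) (a : Adr)
    (hstable : ∀ (h : History Thread Adr Dom Func) (a b : Adr), a ≠ b → h ++ [.free a] ∈ O.spec →
      O.freeable (h ++ [.free a]) b = O.freeable h b)
    (hτ : τ.history ++ [.free a] ∈ O.spec) (hlive : a ∉ τ.live) (hab : a ≠ b) :
    Coupled P O b (.snoc τ ⟨t, .free a, [.ptr (.next a) none, .data (.data a) none]⟩) σ := by
  have key : ∀ c, c ∈ τ.live ∨ c = b →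
      O.freeable (τ.history ++ [.free a]) c ⊆ O.freeable σ.history c := by
    intro c hc
    rw [hstable _ a c (by grind) hτ]
    exact h.incl c hc
  obtain ⟨h1, h2, h3, h4, h5, h6, h7, h8, h9⟩ := h
  have hv : τ.valid \ ({e | τ.mem.ptr e = some (.adr a)} ∪ {.next a}) = τ.valid := by
    ext e
    simp only [Computation.live, Set.mem_ofPred_eq, Set.mem_union, Set.mem_singleton_iff,
      Set.mem_sdiff] at hlive ⊢
    grind
  refine ⟨h1, ?_, ?_, ?_, ?_, ?_, ?_, ?_, ?_⟩ <;>
  simp only [Computation.live, Computation.history, Set.mem_ofPred_eq, Computation.fresh,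
    Computation.freed, valid_free, hv, mem_snoc, Memory.update_cons, Memory.update_nil,
    Memory.ptr_bind_ptr, Memory.ptr_bind_data, Memory.data_bind_ptr, Memory.data_bind_data,
    Set.mem_union, Set.mem_singleton_iff, Set.mem_sdiff] at key hlive h9 ⊢ <;>
  grind

end CoupledSteps

/-! ### From full computations to single-reuse computations. -/

section Reduction

variable {Thread Loc PVar DVar Adr Dom Func OLoc : Type*} {OVar : Type u}

theorem map_ptr_eq_filterMap (m : Memory PVar DVar Adr Dom) (ps : List PVar)
    (hp : ∀ p ∈ ps, ∃ a, m.ptr (.var p) = some (.adr a)) :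
    ps.map (fun p => m.ptr (.var p)) =
      (ps.filterMap fun p => (m.ptr (.var p)).bind PVal.toAdr).map (fun a => some (.adr a)) := by
  induction ps with
  | nil => rfl
  | cons p ps ih =>
    obtain ⟨a, ha⟩ := hp p (by simp)
    simp [ha, PVal.toAdr, ih fun q hq => hp q (by simp [hq])]

theorem map_data_eq_filterMap (m : Memory PVar DVar Adr Dom) (xs : List DVar)
    (hx : ∀ x ∈ xs, ∃ d, m.data (.var x) = some d) :
    xs.map (fun x => m.data (.var x)) =
      (xs.filterMap fun x => m.data (.var x)).map some := by
  induction xs with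
  | nil => rfl
  | cons x xs ih =>
    obtain ⟨d, hd⟩ := hx x (by simp)
    simp [hd, ih fun y hy => hx y (by simp [hy])]

theorem apply_eq_of_map_eq_map {α β γ : Type*} {f : α → γ} {g : β → γ} {l : List α} {l' : List β}
    (h : l.map f = l'.map g) {i : ℕ} {x : α} {y : β} (hx : l[i]? = some x)
    (hy : l'[i]? = some y) : f x = g y := by
  simpa [hx, hy] using congrArg (·[i]?) h

/-- This provides the address to track when an invalid pointer has to be compared. -/
theorem WellFormed.ptr_eq_adr [Zero Dom]
    {τ : Computation Thread PVar DVar Adr Dom Func} (h : WellFormed τ) {p : PVar} (hp : .var p ∉ τ.valid) :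
    ∃ a, τ.mem.ptr (.var p) = some (.adr a) := by
  rcases hm : τ.mem.ptr (.var p) with - | - | a
  · exact absurd hm (h.var_defined p)
  · exact absurd hm (h.invalid _ hp)
  · exact ⟨a, rfl⟩

variable [Zero Dom] [LT Dom] {P : Program Thread Loc PVar DVar Dom Func}
  {O : Observer Func OLoc OVar} {X : Set Adr}
  {τ σ : Computation Thread PVar DVar Adr Dom Func}
  {act : Action Thread PVar DVar Adr Dom Func} {b : Adr}

/-- Were `c` freed in `σ`, neither a valid pointer to `c` nor a valid selector of `c` could exist
there, contradicting that `c` is live. Since it is not freed, every pointer to it is valid. -/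
theorem Coupled.valid_of_live (h : Coupled P O b τ σ) (hr : ReusesOnly b σ) {c : Adr}
    (hc : c ∈ τ.live) (hcb : c ≠ b) {e : PExp PVar Adr} (he : σ.mem.ptr e = some (.adr c)) :
    e ∈ σ.valid := by
  refine hr.valid_of_not_freed c hcb (fun hf => ?_) e he
  rcases hc with ⟨e', he', hc⟩ | hc
  · exact hr.not_valid_of_freed c hcb hf e' (h.valid ▸ he') (h.ptr e' he' ▸ hc)
  · exact hr.next_not_valid c hcb hf (h.valid ▸ hc)

theorem Coupled.exit (h : Coupled P O b τ σ) (t : Thread) :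
    Coupled P O b (.snoc τ ⟨t, .com .exit, []⟩) (.snoc σ ⟨t, .com .exit, []⟩) :=
  ⟨ctrl_snoc_com h.ctrl .., h.valid, h.ptr, h.dvar, h.data,
    fun c hc => freeable_append_mono (by simp) (h.incl c hc), h.var_iff, h.next_iff, h.avail_iff⟩

theorem Coupled.params_defined (h : Coupled P O b τ σ) (hw : WellFormed σ) {ps : List PVar}
    (hp : ∀ p ∈ ps, ∃ a, τ.mem.ptr (.var p) = some (.adr a)) :
    ∀ p ∈ ps, ∃ a, σ.mem.ptr (.var p) = some (.adr a) := by
  intro p hps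
  by_cases hv : .var p ∈ σ.valid
  · rw [← h.ptr _ (h.valid ▸ hv)]
    exact hp p hps
  · exact hw.ptr_eq_adr hv

/-- The arguments of `τ` act as the replacement arguments in the definition of a racy call of `σ`,
so race freedom bounds the behavior after the call in `τ`. -/
theorem Coupled.enter (h : Coupled P O b τ σ) (hw : WellFormed σ) (hr : ReusesOnly b σ) (t : Thread)
    (func : Func) (ps : List PVar) (xs : List DVar)
    (hp : ∀ p ∈ ps, ∃ a, τ.mem.ptr (.var p) = some (.adr a))
    (hx : ∀ x ∈ xs, ∃ d, τ.mem.data (.var x) = some d)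
    (hrace : ¬ RacyCall O σ ⟨t, .com (.enter func ps xs), []⟩) :
    Coupled P O b (.snoc τ ⟨t, .com (.enter func ps xs), []⟩)
      (.snoc σ ⟨t, .com (.enter func ps xs), []⟩) := by
  refine ⟨ctrl_snoc_com h.ctrl .., h.valid, h.ptr, h.dvar, h.data, fun c hc => ?_, h.var_iff,
    h.next_iff, h.avail_iff⟩
  have hτ := map_ptr_eq_filterMap τ.mem ps hp
  have hσ := map_ptr_eq_filterMap σ.mem ps (h.params_defined hw hp)
  have hd := map_data_eq_filterMap τ.mem xs hx
  simp only [h.dvar] at hd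
  simp only [Computation.history, h.dvar]
  -- The intermediate history is that of `σ` followed by the call with the arguments of `τ`.
  refine (freeable_append_mono (by simp) (h.incl c hc)).trans ?_
  by_contra hc'
  refine hrace ⟨func, ps, xs, _, _, rfl, hσ, hd, c, _, ?_, ?_, hc'⟩
  · have hlτ := congrArg List.length hτ
    have hlσ := congrArg List.length hσ
    rw [List.length_map, List.length_map] at hlτ hlσ
    exact hlτ.symm.trans hlσ
  · intro i p x y hi hix hiy hxy
    have hx' := apply_eq_of_map_eq_map hσ hi hix
    have hy' := apply_eq_of_map_eq_map hτ hi hiy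
    have hvalid : .var p ∈ τ.valid → x = y := by
      intro hv
      rw [h.ptr _ hv, hx'] at hy'
      simpa using hy'
    -- An argument of `σ` equal to `c` has to coincide with that of `τ`: by `var_iff` if `c` is `b`,
    -- and otherwise because a pointer to a live address is valid in `σ`.
    rcases hxy with rfl | hv
    · by_cases hxb : x = b
      · subst hxb
        rw [(h.var_iff p).2 hx'] at hy'
        simpa using hy'
      · exact hvalid (h.valid ▸ h.valid_of_live hr (hc.resolve_right hxb) hxb hx')
    · exact hvalid (h.valid ▸ hv)

theorem not_isPointerRace_snoc (hprf : PointerRaceFree O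
      (oneSem P O : Set (Computation Thread PVar DVar Adr Dom Func)))
    (hσ : IsComputation P O {b} σ) (hs : Step P O {b} σ act) :
    ¬ UnsafeAccess σ act ∧ ¬ RacyCall O σ act :=
  not_or.1 (hprf (.snoc σ act) (Set.mem_iUnion.2 ⟨b, .snoc σ act hσ hs⟩))

theorem wellFormed_and_reusesOnly (hprf : PointerRaceFree O
      (oneSem P O : Set (Computation Thread PVar DVar Adr Dom Func)))
    (hσ : IsComputation P O {b} σ) : WellFormed σ ∧ ReusesOnly b σ := by
  induction hσ with
  | nil => exact ⟨.nil, .nil b⟩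
  | snoc σ act hσ hs ih =>
    have hu := (not_isPointerRace_snoc hprf hσ hs).1
    exact ⟨ih.1.snoc hs hu, ih.2.snoc hs hu⟩

/-- This gives the inclusion of the single-reuse semantics in the full one, hence the easy half of
the theorem. -/
theorem IsComputation.mono {Y : Set Adr} (hXY : X ⊆ Y) (h : IsComputation P O X τ) :
    IsComputation P O Y τ := by
  induction h with
  | nil => exact .nil
  | snoc τ act _ hs ih =>
    refine .snoc τ act ih ?_
    cases hs with
    | free t a ha => exact .free t a ha
    | com t c up hc hup =>
      refine .com t c up hc ?_
      cases hup with
      | malloc p a d ha => exact .malloc p a d (ha.imp_right fun h => ⟨h.1, hXY h.2⟩)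
      | _ => constructor <;> assumption

theorem Coupled.nil : Coupled P O b (Computation.nil) (Computation.nil) := by
  constructor <;> simp

/-- For every address `b`, the computation `τ` has a counterpart reusing only `b`. -/
def Reducible (P : Program Thread Loc PVar DVar Dom Func) (O : Observer Func OLoc OVar)
    (τ : Computation Thread PVar DVar Adr Dom Func) : Prop :=
  ∀ b, ∃ σ, IsComputation P O {b} σ ∧ Coupled P O b τ σ

theorem Reducible.not_unsafeAccess (h : Reducible P O τ) (hprf : PointerRaceFree O
      (oneSem P O : Set (Computation Thread PVar DVar Adr Dom Func)))
    (hs : Step P O X τ act) : ¬ UnsafeAccess τ act := by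
  rintro ⟨c, p, hcom, hd, hp⟩
  obtain ⟨a, ha⟩ : ∃ a, τ.mem.ptr (.var p) = some (.adr a) := by
    cases hs with
    | free t a ha => cases hcom
    | com t c' up hc hup =>
      cases hcom
      cases hup <;> simp only [Com.Derefs] at hd <;> subst hd <;> exact ⟨_, ‹_›⟩
  -- Tracking the address held by `p` ensures that `p` holds it in `σ` too, so the same access is
  -- executable there.
  obtain ⟨σ, hσ, hcp⟩ := h a
  have haσ := (hcp.var_iff p).1 ha
  have key : ∃ act', Step P O {a} σ act' ∧ act'.com = act.com := by
    cases hs with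
    | free t a ha => cases hcom
    | com t c' up hc hup =>
      cases hcom
      rw [hcp.ctrl] at hc
      cases hup with
      | loadNext p' q _ _ =>
        cases hd
        exact ⟨_, .com t _ _ hc (.loadNext p' p a haσ), rfl⟩
      | storeNext p' q _ _ =>
        cases hd
        exact ⟨_, .com t _ _ hc (.storeNext p q a haσ), rfl⟩
      | loadData x q _ _ =>
        cases hd
        exact ⟨_, .com t _ _ hc (.loadData x p a haσ), rfl⟩
      | storeData p' y _ _ =>
        cases hd
        exact ⟨_, .com t _ _ hc (.storeData p y a haσ), rfl⟩
      | _ => cases hd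
  obtain ⟨act', hs', hcom'⟩ := key
  exact (not_isPointerRace_snoc hprf hσ hs').1 ⟨c, p, hcom'.trans hcom, hd, hcp.valid ▸ hp⟩

/-- If a compared pointer is invalid, its address is tracked, and `var_iff` then decides the
comparison equally in both memories. Otherwise valid memory or data variables already agree and any
address will do. -/
theorem Reducible.exists_holds [Nonempty Adr] (h : Reducible P O τ) (hw : WellFormed τ)
    {c : Cond PVar DVar} (hc : c.Holds τ.mem) :
    ∃ a σ, IsComputation P O {a} σ ∧ Coupled P O a τ σ ∧ c.Holds σ.mem := by
  have hptr : ∀ p q : PVar, ∃ a σ, IsComputation P O {a} σ ∧ Coupled P O a τ σ ∧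
      (τ.mem.ptr (.var p) = τ.mem.ptr (.var q) ↔ σ.mem.ptr (.var p) = σ.mem.ptr (.var q)) := by
    intro p q
    by_cases hp : .var p ∈ τ.valid
    · by_cases hq : .var q ∈ τ.valid
      · obtain ⟨a⟩ := ‹Nonempty Adr›
        obtain ⟨σ, hσ, hcp⟩ := h a
        exact ⟨a, σ, hσ, hcp, by rw [hcp.ptr _ hp, hcp.ptr _ hq]⟩
      · obtain ⟨a, ha⟩ := hw.ptr_eq_adr hq
        obtain ⟨σ, hσ, hcp⟩ := h a
        exact ⟨a, σ, hσ, hcp, by rw [ha, (hcp.var_iff q).1 ha, hcp.ptr _ hp]⟩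
    · obtain ⟨a, ha⟩ := hw.ptr_eq_adr hp
      obtain ⟨σ, hσ, hcp⟩ := h a
      refine ⟨a, σ, hσ, hcp, ?_⟩
      rw [ha, (hcp.var_iff p).1 ha, eq_comm, hcp.var_iff q, eq_comm]
  cases c with
  | ptrEq p q =>
    obtain ⟨a, σ, hσ, hcp, hpq⟩ := hptr p q
    exact ⟨a, σ, hσ, hcp, hpq.1 hc⟩
  | ptrNe p q =>
    obtain ⟨a, σ, hσ, hcp, hpq⟩ := hptr p q
    exact ⟨a, σ, hσ, hcp, hpq.not.1 hc⟩
  | _ =>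
    obtain ⟨a⟩ := ‹Nonempty Adr›
    obtain ⟨σ, hσ, hcp⟩ := h a
    refine ⟨a, σ, hσ, hcp, ?_⟩
    simpa only [Cond.Holds, hcp.dvar] using hc

theorem Reducible.of_compatible (h : Reducible P O τ) (hcompat : ReductionCompatible Adr P O)
    (hprf : PointerRaceFree O (oneSem P O : Set (Computation Thread PVar DVar Adr Dom Func)))
    (hτ : IsComputation P O Set.univ (.snoc τ act)) (hw : WellFormed (.snoc τ act)) {a : Adr}
    (hσ : IsComputation P O {a} (.snoc σ act)) (hc : Coupled P O a τ σ)
    (hc' : Coupled P O a (.snoc τ act) (.snoc σ act)) (hact : act.IsAssert ∨ act.IsMallocOf a) :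
    Reducible P O (.snoc τ act) := by
  intro b
  by_cases hab : a = b
  · subst hab
    exact ⟨_, hσ, hc'⟩
  · obtain ⟨σb, hσb, hcb⟩ := h b
    have hsim : Similar P σ σb := ⟨hc.ctrl.symm.trans hcb.ctrl,
      hc.similar.2.symm.trans hcb.similar.2⟩
    obtain ⟨σ', hσ', h1, h2, h3⟩ := hcompat.1 a b τ σ σb act hτ hσ hσb hc.similar hc.obsIncl
      hc.memEquiv hc'.similar hc'.obsIncl hc'.memEquiv hcb.similar hcb.obsIncl hcb.memEquiv hsim
      hab hact
    exact ⟨σ', hσ', .of_relations hw (wellFormed_and_reusesOnly hprf hσ').1 h1 h2 h3⟩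

theorem Reducible.snoc [Nonempty Adr] (h : Reducible P O τ) (hcompat : ReductionCompatible Adr P O)
    (hprf : PointerRaceFree O (oneSem P O : Set (Computation Thread PVar DVar Adr Dom Func)))
    (hτ : IsComputation P O Set.univ τ) (hw : WellFormed τ) (hs : Step P O Set.univ τ act) :
    Reducible P O (.snoc τ act) := by
  have hu := h.not_unsafeAccess hprf hs
  have hτ' := hτ.snoc τ act hs
  have hw' := hw.snoc hs hu
  cases hs with
  | free t a ha =>
    intro b
    obtain ⟨σ, hσ, hcp⟩ := h b
    by_cases hlive : a ∈ τ.live ∨ a = b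
    · exact ⟨_, hσ.snoc σ _ (.free t a (free_mem_spec (hcp.incl a hlive) ha)),
        hcp.free t a hcompat.2 ha hlive⟩
    · rw [not_or] at hlive
      exact ⟨σ, hσ, hcp.free_left t a hcompat.2 ha hlive.1 hlive.2⟩
  | com t c up hc hup =>
    have hvalid : ∀ p, c.Derefs p → .var p ∈ τ.valid := fun p hp => by
      by_contra hpv
      exact hu ⟨c, p, rfl, hp, hpv⟩
    cases hup with
    | malloc p a d ha =>
      obtain ⟨σ, hσ, hcp⟩ := h a
      -- `σ` may reuse `a`, so it is irrelevant whether `a` is fresh or freed there.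
      have ha' := hcp.avail_iff.1 (ha.imp_right And.left)
      exact h.of_compatible hcompat hprf hτ' hw' (hσ.snoc σ _ (.com t _ _ (hcp.ctrl ▸ hc)
        (.malloc p a d (ha'.imp_right fun h => ⟨h, rfl⟩)))) hcp (hcp.malloc t p d)
        (.inr ⟨p, rfl, by simp⟩)
    | assert c hcond =>
      obtain ⟨a, σ, hσ, hcp, hcσ⟩ := h.exists_holds hw hcond
      exact h.of_compatible hcompat hprf hτ' hw' (hσ.snoc σ _ (.com t _ _ (hcp.ctrl ▸ hc)
        (.assert c hcσ))) hcp (hcp.assert t c hcond hcσ) (.inl ⟨c, rfl⟩)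
    | enter func ps xs hp hx =>
      intro b
      obtain ⟨σ, hσ, hcp⟩ := h b
      obtain ⟨hwσ, hr⟩ := wellFormed_and_reusesOnly hprf hσ
      have hsσ : Step P O {b} σ ⟨t, .com (.enter func ps xs), []⟩ :=
        .com t _ _ (hcp.ctrl ▸ hc) (.enter func ps xs (hcp.params_defined hwσ hp)
          (by simpa only [hcp.dvar] using hx))
      exact ⟨_, hσ.snoc σ _ hsσ,
        hcp.enter hwσ hr t func ps xs hp hx (not_isPointerRace_snoc hprf hσ hsσ).2⟩
    | exit =>
      intro b
      obtain ⟨σ, hσ, hcp⟩ := h b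
      exact ⟨_, hσ.snoc σ _ (.com t _ _ (hcp.ctrl ▸ hc) .exit), hcp.exit t⟩
    | assign p q =>
      intro b
      obtain ⟨σ, hσ, hcp⟩ := h b
      exact ⟨_, hσ.snoc σ _ (.com t _ _ (hcp.ctrl ▸ hc) (.assign p q)), hcp.assign t p q⟩
    | storeNext p q a ha =>
      intro b
      obtain ⟨σ, hσ, hcp⟩ := h b
      have hp := hvalid p rfl
      exact ⟨_, hσ.snoc σ _ (.com t _ _ (hcp.ctrl ▸ hc) (.storeNext p q a (hcp.ptr _ hp ▸ ha))),
        hcp.storeNext t p q a hp ha⟩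
    | loadNext p q a ha =>
      intro b
      obtain ⟨σ, hσ, hcp⟩ := h b
      have hq := hvalid q rfl
      exact ⟨_, hσ.snoc σ _ (.com t _ _ (hcp.ctrl ▸ hc) (.loadNext p q a (hcp.ptr _ hq ▸ ha))),
        hcp.loadNext t p q a hq ha⟩
    | assignOp x op ys ds hd =>
      intro b
      obtain ⟨σ, hσ, hcp⟩ := h b
      exact ⟨_, hσ.snoc σ _ (.com t _ _ (hcp.ctrl ▸ hc) (.assignOp x op ys ds
        (by simpa only [hcp.dvar] using hd))), hcp.assignOp t x op ys _⟩
    | storeData p y a ha =>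
      intro b
      obtain ⟨σ, hσ, hcp⟩ := h b
      have hs := Step.com (O := O) t _ _ (hcp.ctrl ▸ hc)
        (Exec.storeData (X := {b}) p y a (hcp.ptr _ (hvalid p rfl) ▸ ha))
      -- The two updates become literally equal.
      rw [hcp.dvar]
      exact ⟨_, hσ.snoc σ _ hs, hcp.storeData t p y a _⟩
    | loadData x q a ha =>
      intro b
      obtain ⟨σ, hσ, hcp⟩ := h b
      have hq := hvalid q rfl
      have hs := Step.com (O := O) t _ _ (hcp.ctrl ▸ hc)
        (Exec.loadData (X := {b}) x q a (hcp.ptr _ hq ▸ ha))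
      rw [hcp.data _ hq a ha]
      exact ⟨_, hσ.snoc σ _ hs, hcp.loadData t x q _⟩

/-- The two properties need a joint induction: well-formedness of an extension uses that its access
is safe, which comes from reducibility, while reducibility uses well-formedness for assertions and
for recovering couplings from the relations. -/
theorem wellFormed_and_reducible [Nonempty Adr] (hcompat : ReductionCompatible Adr P O)
    (hprf : PointerRaceFree O (oneSem P O : Set (Computation Thread PVar DVar Adr Dom Func)))
    (hτ : IsComputation P O Set.univ τ) : WellFormed τ ∧ Reducible P O τ := by
  induction hτ with
  | nil => exact ⟨.nil, fun b => ⟨.nil, .nil, .nil⟩⟩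
  | snoc τ act hτ hs ih =>
    exact ⟨ih.1.snoc hs (ih.2.not_unsafeAccess hprf hs), ih.2.snoc hcompat hprf hτ ih.1 hs⟩

end Reduction

end SMR

theorem mainTheorem4 {Thread Loc PVar DVar Adr Dom Func OLoc OVar : Type*}
    [Zero Dom] [LT Dom] [Nonempty Adr]
    (P : SMR.Program Thread Loc PVar DVar Dom Func) (O : SMR.Observer Func OLoc OVar)
    (hcompat : SMR.ReductionCompatible Adr P O)
    (hprf : SMR.PointerRaceFree O
      (SMR.oneSem P O : Set (SMR.Computation Thread PVar DVar Adr Dom Func))) :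
    SMR.SetSimilar P
      (SMR.allSem P O : Set (SMR.Computation Thread PVar DVar Adr Dom Func))
      (SMR.oneSem P O) := by
  refine ⟨fun τ hτ => ?_, fun σ hσ => ?_⟩
  · obtain ⟨b⟩ := ‹Nonempty Adr›
    obtain ⟨σ, hσ, hc⟩ := (SMR.wellFormed_and_reducible hcompat hprf hτ).2 b
    exact ⟨σ, Set.mem_iUnion.2 ⟨b, hσ⟩, hc.similar⟩
  · obtain ⟨a, ha⟩ := Set.mem_iUnion.1 hσ
    exact ⟨σ, SMR.IsComputation.mono (Set.subset_univ _) ha, rfl, rfl⟩
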